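/- Let $X$ be a finite simple undirected bipartite graph whose edges carry nonzero real weights $\omega_{uv}$. Let $A$ be its weighted adjacency matrix ($A_{u,v}=\omega_{uv}$ if $u,v$ are adjacent and $A_{u,v}=0$ otherwise) and let $U(t)=e^{itA}$. For a real number $\theta$ let $E_\theta$ be the matrix of the orthogonal projection onto the $\theta$-eigenspace of $A$. The eigenvalue support of a vertex $u$ is $\Phi_u=\{\theta : \theta \text{ is an eigenvalue of } A,\ E_\theta\mathbf e_u\neq 0\}$, and $\Phi_u^+=\Phi_u\cap(0,\infty)$. The vertex $u$ is *not sedentary* if $\inf_{t>0}|U(t)_{u,u}|=0$. Write $\nu_2(n)$ for the exponent of the largest power of $2$ dividing the integer $n$, with $\nu_2(0)=\infty$. Let $u$ be a vertex of $X$ with $0\in\Phi_u$. **A.** Let $S$ be a nonempty subset of $\Phi_u^+$ such that $\alpha:=\sum_{\lambda\in S}(E_\lambda)_{u,u}\ge\frac14$, and let $\zeta:=\arccos\left(-\frac{1}{4\alpha}\right)$. Then $\zeta\in\left(\frac{\pi}{2},\pi\right]$. For a tuple of integers $(\ell_\lambda)_{\lambda\in S}$ and a (possibly empty) subset $S'\subseteq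 S$ put $D_{S'}=\sum_{\lambda\in S\setminus S'}\ell_\lambda-\sum_{\lambda\in S'}\ell_\lambda$. 1. Suppose $\zeta\notin\mathbb Q\pi$. If there is a subset $S'\subseteq S$ such that, for every tuple of integers $(\ell_\lambda)_{\lambda\in S}$, $\sum_{\lambda\in S}\lambda\ell_\lambda=0$ implies $D_{S'}=0$, then $u$ is not sedentary. 2. Suppose $\zeta=\frac{a\pi}{b}$ with integers $a$ and $b\ne0$, $\gcd(a,b)=1$. If there is a subset $S'\subseteq S$ such that, for every tuple of integers $(\ell_\lambda)_{\lambda\in S}$, $\sum_{\lambda\in S}\lambda\ell_\lambda=0$ implies that $b$ divides $D_{S'}$ and $\nu_2(D_{S'})>\nu_2(b)-\nu_2(a)$, then $u$ is not sedentary. In both cases, for every $S'$ as in the condition and every $\varepsilon>0$ there is a time $t>0$ such that, for every $\lambda\in S\setminus S'$ (respectively every $\lambda\in S'$), $t$ is within $\varepsilon$ of $-\frac{\zeta}{\lambda}$ (respectively of $\frac{\zeta}{\lambda}$) modulo $\frac{2\pi}{\lambda}$, and such that $U(t)_{u,u}$ is real with $U(t)_{u,u}\le\varepsilon$; if moreover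 $\alpha>\frac14$, or if the quotient of any two elements of $S$ is rational, then $t$ can be chosen so that also $U(t)_{u,u}\le 0$. 3. If $S$ is linearly independent over $\mathbb Q$, or if $S$ consists of integers that all have the same value of $\nu_2$, then $u$ is not sedentary. **B.** Suppose $(E_0)_{u,u}<\frac12$. If $|\Phi_u^+|=1$, or if $|\Phi_u^+|\ge2$ and either $\Phi_u^+$ consists of integers that all have the same value of $\nu_2$ or $\Phi_u^+$ is linearly independent over $\mathbb Q$, then $u$ is not sedentary. -/

import Mathlib

/-- A simple undirected graph together with a nonzero real weight on each of its edges.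
The values of `weight` on pairs that are not edges are irrelevant. -/
structure WeightedGraph (V : Type*) where
  graph : SimpleGraph V
  weight : Sym2 V → ℝ
  weight_ne_zero : ∀ e ∈ graph.edgeSet, weight e ≠ 0

namespace WeightedGraph

variable {V : Type*} (X : WeightedGraph V)

open Classical in
/-- The (weighted) adjacency matrix `A`. -/
noncomputable def adjMatrix : Matrix V V ℝ :=
  Matrix.of fun u v => if X.graph.Adj u v then X.weight s(u, v) else 0

variable [Fintype V] [DecidableEq V]

/-- The transition matrix `U(t) = exp(i t A)` of the continuous-time quantum walk. -/
noncomputable def transitionMatrix (t : ℝ) : Matrix V V ℂ :=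
  NormedSpace.exp ((Complex.I * (t : ℂ)) • X.adjMatrix.map (fun x : ℝ => (x : ℂ)))

/-- `E_θ`: the matrix of the orthogonal projection of `ℝ^V` onto the `θ`-eigenspace of `A`
(the zero matrix if `θ` is not an eigenvalue). -/
noncomputable def eigenProjection (θ : ℝ) : Matrix V V ℝ :=
  Matrix.toEuclideanLin.symm
    ((Module.End.eigenspace (Matrix.toEuclideanLin X.adjMatrix) θ).starProjection.toLinearMap)

/-- The eigenvalue support of the vertex `u`: the eigenvalues `θ` of `A` with `E_θ e_u ≠ 0`. -/
def eigenvalueSupport (u : V) : Set ℝ :=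
  {θ | θ ∈ spectrum ℝ X.adjMatrix ∧ Matrix.mulVec (X.eigenProjection θ) (Pi.single u 1) ≠ 0}

/-- The positive part of the eigenvalue support of `u`. -/
def positiveSupport (u : V) : Set ℝ :=
  X.eigenvalueSupport u ∩ Set.Ioi 0

/-- The vertex `u` is not sedentary: `inf_{t > 0} |U(t)_{u,u}| = 0`. -/
def NotSedentary (u : V) : Prop :=
  ⨅ t : Set.Ioi (0 : ℝ), ‖X.transitionMatrix (t : ℝ) u u‖ = 0

/-- `α = ∑_{λ ∈ S} (E_λ)_{u,u}`. -/
noncomputable def idempotentWeight (u : V) (S : Finset ℝ) : ℝ :=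
  ∑ x ∈ S, X.eigenProjection x u u

/-- `S` is a nonempty set of positive eigenvalues in the support of `u`, with `α ≥ 1/4`. -/
def IsAdmissible (u : V) (S : Finset ℝ) : Prop :=
  S.Nonempty ∧ (S : Set ℝ) ⊆ X.positiveSupport u ∧ 1 / 4 ≤ X.idempotentWeight u S

/-- `ζ = arccos (-1/(4α))`. -/
noncomputable def angle (u : V) (S : Finset ℝ) : ℝ :=
  Real.arccos (-(1 / (4 * X.idempotentWeight u S)))

/-- `U(t)_{u,u} ≤ 0` up to approximation, at times `t` with `t ≈ ζ/λ`, that is, within `ε` of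
`-ζ/λ` (for `λ ∈ S \ S'`) or of `ζ/λ` (for `λ ∈ S'`) modulo `2π/λ`, simultaneously for all
`λ ∈ S`. The value `U(t)_{u,u}` is real and at most `ε`; it is at most `0` if `α > 1/4` or if
the elements of `S` are pairwise commensurable. -/
def NonposNear (u : V) (S S' : Finset ℝ) : Prop :=
  ∀ ε : ℝ, 0 < ε → ∃ t : ℝ, 0 < t ∧
    (∀ x ∈ S \ S', ∃ k : ℤ, |t - (-X.angle u S + 2 * Real.pi * k) / x| < ε) ∧
    (∀ x ∈ S', ∃ k : ℤ, |t - (X.angle u S + 2 * Real.pi * k) / x| < ε) ∧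
    (X.transitionMatrix t u u).im = 0 ∧
    (X.transitionMatrix t u u).re ≤ ε ∧
    ((1 / 4 < X.idempotentWeight u S ∨ ∀ x ∈ S, ∀ y ∈ S, ∃ q : ℚ, x = q * y) →
      (X.transitionMatrix t u u).re ≤ 0)

end WeightedGraph

/-- `∑_{λ ∈ S} λ ℓ_λ = 0`. Only the values of `ℓ` on `S` matter, so `ℓ` stands for a tuple of
integers indexed by `S`. -/
def IsIntegerRelation (S : Finset ℝ) (l : ℝ → ℤ) : Prop :=
  ∑ x ∈ S, x * (l x : ℝ) = 0

/-- `D_{S'} = ∑_{λ ∈ S \ S'} ℓ_λ - ∑_{λ ∈ S'} ℓ_λ`. -/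
noncomputable def signedSum (S S' : Finset ℝ) (l : ℝ → ℤ) : ℤ :=
  ∑ x ∈ S \ S', l x - ∑ x ∈ S', l x

/-- The 2-adic valuation of an integer, with `ν₂(0) = ∞`. -/
noncomputable def nu2 (n : ℤ) : ℕ∞ := emultiplicity 2 n

/-- All elements of `T` are integers, and they have the same (finite) 2-adic valuation. -/
def IsIntegralWithEqualNu2 (T : Set ℝ) : Prop :=
  ∃ η : ℕ, ∀ x ∈ T, ∃ k : ℤ, x = k ∧ nu2 k = η

/-!
For an orthonormal eigenbasis `vᵢ` of `A` with eigenvalues `μᵢ`, one has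
`U(t)_{u,u} = ∑ᵢ e^{itμᵢ} vᵢ(u)²` and `(E_θ)_{u,u}` is the sum of the `vᵢ(u)²` with `μᵢ = θ`.
In a bipartite graph, changing signs on one part turns `A` into `-A`, so
`(E_{-θ})_{u,u} = (E_θ)_{u,u}` and `U(t)_{u,u} = ∑ᵢ cos(tμᵢ) vᵢ(u)²` is real. The eigenvalues in
`±S` have total weight `2α` at `u`; bounding the other cosines by `1` gives
`U(t)_{u,u} ≤ 1 - 2α + 2 ∑_{λ ∈ S} cos(tλ) (E_λ)_{u,u}` (`WeightedGraph.transitionMatrix_re_le`).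
If `tλ` is near `±ζ` modulo `2π` for all `λ ∈ S`, then all these cosines are near
`cos ζ = -1/(4α)`, and the bound is near `1/2 - 2α ≤ 0`. Since `U(0)_{u,u} = 1`, the intermediate
value theorem then shows that `u` is not sedentary
(`WeightedGraph.notSedentary_of_forall_exists_re_le`).

Such times exist by Kronecker's theorem (`kronecker_approximation`): phases `θᵢ` can be approximated
by `tλᵢ` modulo `2π` as soon as each integer relation between the `λᵢ` holds for the `θᵢ` modulo
`2π`. For the phases `∓ζ` this condition reads `ζ D_{S'} ∈ 2πℤ`, which is what the hypotheses on the
relations say. The proof of Kronecker's theorem compares, for large `k`, the `k`-th power of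
`F(t) = 1 + ∑ᵢ e^{i(tλᵢ - θᵢ)}` with its Fourier coefficients: each of them is at most `sup |F|^k`,
there are only polynomially many, and as terms of equal frequency do not cancel they add up to
`(n+1)^k` in absolute value; so `sup |F| = n + 1`. When the `λᵢ` are commensurable, Bézout's identity
solves the congruences exactly (`kronecker_exact_of_commensurable`), which is needed to reach
`U(t)_{u,u} ≤ 0` when `α = 1/4` and the bound has no room for an error.

If `S` consists of integers of `2`-adic valuation `η`, the time `π/2^η` makes all the cosines equal
to `-1`. If `(E_0)_{u,u} < 1/2`, then the whole positive support has `α = (1 - (E_0)_{u,u})/2 > 1/4`.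
-/

/-! ### Simultaneous approximation -/

section

open Filter Topology

/-- The mean value of the character `t ↦ e^{iνt}` is `1` for `ν = 0` and `0` otherwise. -/
theorem tendsto_average_exp (ν : ℝ) :
    Tendsto (fun T : ℝ => (T : ℂ)⁻¹ * ∫ t in (0 : ℝ)..T, Complex.exp (Complex.I * ν * t)) atTop
      (𝓝 (if ν = 0 then 1 else 0)) := by
  split_ifs with h
  · refine tendsto_const_nhds.congr' ?_
    filter_upwards [eventually_gt_atTop 0] with T hT
    have hT' : (T : ℂ) ≠ 0 := by exact_mod_cast hT.ne'
    simp [h, hT']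
  · have hc : Complex.I * (ν : ℂ) ≠ 0 := mul_ne_zero Complex.I_ne_zero (by exact_mod_cast h)
    have hb : ∀ T : ℝ, ‖∫ t in (0 : ℝ)..T, Complex.exp (Complex.I * ν * t)‖ ≤
        2 / ‖Complex.I * (ν : ℂ)‖ := by
      intro T
      rw [integral_exp_mul_complex hc, norm_div]
      gcongr
      refine (norm_sub_le _ _).trans ?_
      have : ∀ x : ℝ, ‖Complex.exp (Complex.I * ν * x)‖ = 1 := by
        intro x
        rw [Complex.norm_exp]
        simp
      rw [this, this]
      norm_num
    have h0 : Tendsto (fun T : ℝ => (T : ℂ)⁻¹) atTop (𝓝 0) := by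
      have := (Complex.continuous_ofReal.tendsto 0).comp tendsto_inv_atTop_zero
      simpa [Function.comp_def] using this
    exact h0.zero_mul_isBoundedUnder_le (isBoundedUnder_of ⟨_, hb⟩)

/-- A Fourier coefficient of a trigonometric polynomial is at most its supremum on `(0, ∞)`. -/
theorem norm_coeff_le_of_norm_trigPoly_le {κ : Type*} [Fintype κ] (c : κ → ℂ) (ν : κ → ℝ)
    {R : ℝ} (hR : ∀ t : ℝ, 0 < t → ‖∑ j, c j * Complex.exp (Complex.I * ν j * t)‖ ≤ R) (μ : ℝ) :
    ‖∑ j with ν j = μ, c j‖ ≤ R := by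
  have hlim : Tendsto (fun T : ℝ => ∑ j, c j * ((T : ℂ)⁻¹ *
      ∫ t in (0 : ℝ)..T, Complex.exp (Complex.I * (ν j - μ : ℝ) * t))) atTop
      (𝓝 (∑ j, c j * (if ν j - μ = 0 then 1 else 0))) :=
    tendsto_finsetSum _ fun j _ => (tendsto_average_exp (ν j - μ)).const_mul (c j)
  have hsum : ∑ j, c j * (if ν j - μ = 0 then 1 else 0) = ∑ j with ν j = μ, c j := by
    simp [Finset.sum_filter, sub_eq_zero]
  rw [hsum] at hlim
  refine le_of_tendsto hlim.norm ?_
  filter_upwards [eventually_gt_atTop 0] with T hT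
  have hcomb : ∑ j, c j * ((T : ℂ)⁻¹ *
      ∫ t in (0 : ℝ)..T, Complex.exp (Complex.I * (ν j - μ : ℝ) * t)) = (T : ℂ)⁻¹ *
      ∫ t in (0 : ℝ)..T, Complex.exp (-(Complex.I * μ * t)) *
        ∑ j, c j * Complex.exp (Complex.I * ν j * t) := by
    have : ∀ t : ℝ, Complex.exp (-(Complex.I * μ * t)) *
        ∑ j, c j * Complex.exp (Complex.I * ν j * t) =
        ∑ j, c j * Complex.exp (Complex.I * (ν j - μ : ℝ) * t) := by
      intro t
      rw [Finset.mul_sum]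
      refine Finset.sum_congr rfl fun j _ => ?_
      rw [mul_left_comm, ← Complex.exp_add]
      congr 2
      push_cast
      ring
    simp_rw [this]
    rw [intervalIntegral.integral_finsetSum]
    · simp_rw [intervalIntegral.integral_const_mul, Finset.mul_sum]
      exact Finset.sum_congr rfl fun j _ => by ring
    · intro j _
      exact Continuous.intervalIntegrable (by fun_prop) _ _
  rw [hcomb, norm_mul, norm_inv, Complex.norm_real, Real.norm_of_nonneg hT.le,
    inv_mul_le_iff₀ hT]
  have hbound := intervalIntegral.norm_integral_le_of_norm_le_const (a := (0 : ℝ)) (b := T)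
    (C := R) (f := fun t : ℝ => Complex.exp (-(Complex.I * μ * t)) *
        ∑ j, c j * Complex.exp (Complex.I * ν j * t)) ?_
  · rwa [sub_zero, abs_of_pos hT, mul_comm R] at hbound
  · intro t ht
    rw [Set.uIoc_of_le hT.le] at ht
    rw [norm_mul, Complex.norm_exp]
    simpa using hR t ht.1

/-- The value at `f` of the additive functional with weights `x`, in terms of the number of
times `f` takes each value. -/
theorem sum_comp_eq_sum_card_mul {κ : Type*} [Fintype κ] [DecidableEq κ] {k : ℕ} (x : κ → ℝ)
    (f : Fin k → κ) : ∑ j, x (f j) =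
      ∑ i, ((Finset.univ.filter fun j => f j = i).card : ℝ) * x i := by
  rw [← Finset.sum_fiberwise (s := Finset.univ) (g := f)]
  refine Finset.sum_congr rfl fun i _ => ?_
  rw [Finset.sum_congr rfl (g := fun _ => x i) (by simp +contextual), Finset.sum_const,
    nsmul_eq_mul]

/-- Expanding the `k`-th power of `∑ᵢ e^{i(λᵢt - θᵢ)}` gives `|κ|^k` unimodular terms with at most
`(k+1)^|κ|` distinct frequencies; the hypothesis on relations says that terms with the same
frequency are equal, so they do not cancel. -/
theorem card_pow_le_of_norm_sum_exp_le {κ : Type*} [Fintype κ] (lam θ : κ → ℝ)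
    (h : ∀ l : κ → ℤ, ∑ i, (l i : ℝ) * lam i = 0 → ∑ i, l i = 0 →
      ∃ m : ℤ, ∑ i, (l i : ℝ) * θ i = 2 * Real.pi * m) {r : ℝ}
    (hr : ∀ t : ℝ, 0 < t → ‖∑ i, Complex.exp (Complex.I * (lam i * t - θ i))‖ ≤ r) (k : ℕ) :
    (Fintype.card κ : ℝ) ^ k ≤ ((k : ℝ) + 1) ^ Fintype.card κ * r ^ k := by
  classical
  set Λ : (Fin k → κ) → ℝ := fun f => ∑ j, lam (f j) with hΛ
  set Θ : (Fin k → κ) → ℝ := fun f => ∑ j, θ (f j) with hΘ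
  set c : (Fin k → κ) → ℂ := fun f => Complex.exp (-(Complex.I * Θ f)) with hc
  have hcnorm : ∀ f, ‖c f‖ = 1 := by
    intro f
    simp only [hc, Complex.norm_exp]
    simp
  have hexpand : ∀ t : ℝ, (∑ i, Complex.exp (Complex.I * (lam i * t - θ i))) ^ k =
      ∑ f, c f * Complex.exp (Complex.I * Λ f * t) := by
    intro t
    rw [Fintype.sum_pow]
    refine Finset.sum_congr rfl fun f _ => ?_
    rw [← Complex.exp_sum, hc, ← Complex.exp_add]
    congr 1
    simp only [hΛ, hΘ, Complex.ofReal_sum, Finset.mul_sum, Finset.sum_mul,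
      ← Finset.sum_neg_distrib, ← Finset.sum_add_distrib]
    exact Finset.sum_congr rfl fun j _ => by ring
  have hbound : ∀ t : ℝ, 0 < t → ‖∑ f, c f * Complex.exp (Complex.I * Λ f * t)‖ ≤ r ^ k := by
    intro t ht
    rw [← hexpand, norm_pow]
    exact pow_le_pow_left₀ (norm_nonneg _) (hr t ht) k
  have hsame : ∀ f g, Λ f = Λ g → c f = c g := by
    intro f g hfg
    set l : κ → ℤ := fun i => ((Finset.univ.filter fun j => f j = i).card : ℤ) -
      ((Finset.univ.filter fun j => g j = i).card : ℤ) with hl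
    have hdiff : ∀ x : κ → ℝ, ∑ i, (l i : ℝ) * x i = ∑ j, x (f j) - ∑ j, x (g j) := by
      intro x
      rw [sum_comp_eq_sum_card_mul x f, sum_comp_eq_sum_card_mul x g, ← Finset.sum_sub_distrib]
      refine Finset.sum_congr rfl fun i _ => ?_
      simp only [hl]
      push_cast
      ring
    obtain ⟨m, hm⟩ := h l (by rw [hdiff]; exact sub_eq_zero.2 hfg) (by
      have := hdiff fun _ => 1
      simp only [mul_one, sub_self] at this
      exact_mod_cast this)
    rw [hdiff] at hm
    have hm' : Θ f = Θ g + 2 * Real.pi * m := by rw [← hm]; simp only [hΘ]; ring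
    simp only [hc]
    rw [hm', Complex.exp_eq_exp_iff_exists_int]
    refine ⟨-m, ?_⟩
    push_cast
    ring
  have hfiber : ∀ μ : ℝ, ((Finset.univ.filter fun f => Λ f = μ).card : ℝ) ≤ r ^ k := by
    intro μ
    rcases (Finset.univ.filter fun f => Λ f = μ).eq_empty_or_nonempty with he | ⟨f, hf⟩
    · rw [he]
      simpa using (norm_nonneg _).trans (hbound 1 one_pos)
    · have := norm_coeff_le_of_norm_trigPoly_le c Λ hbound μ
      rw [Finset.sum_congr rfl (g := fun _ => c f) fun g hg => hsame g f
        ((Finset.mem_filter.1 hg).2.trans (Finset.mem_filter.1 hf).2.symm)] at this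
      simpa [hcnorm] using this
  have himage : (Finset.univ.image Λ).card ≤ (k + 1) ^ Fintype.card κ := by
    have hsub : Finset.univ.image Λ ⊆ Finset.univ.image
        (fun n : κ → Fin (k + 1) => ∑ i, ((n i : ℕ) : ℝ) * lam i) := by
      intro μ hμ
      obtain ⟨f, -, rfl⟩ := Finset.mem_image.1 hμ
      refine Finset.mem_image.2 ⟨fun i => ⟨(Finset.univ.filter fun j => f j = i).card, ?_⟩,
        Finset.mem_univ _, ?_⟩
      · exact Nat.lt_succ_of_le ((Finset.card_le_univ _).trans_eq (Fintype.card_fin k))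
      · exact (sum_comp_eq_sum_card_mul lam f).symm
    refine (Finset.card_le_card hsub).trans (Finset.card_image_le.trans ?_)
    simp
  have hcard : (Fintype.card κ) ^ k =
      ∑ μ ∈ Finset.univ.image Λ, (Finset.univ.filter fun f => Λ f = μ).card := by
    rw [← Finset.card_eq_sum_card_image]
    simp
  calc (Fintype.card κ : ℝ) ^ k
      = ∑ μ ∈ Finset.univ.image Λ, ((Finset.univ.filter fun f => Λ f = μ).card : ℝ) := by
        exact_mod_cast hcard
    _ ≤ ∑ _μ ∈ Finset.univ.image Λ, r ^ k := Finset.sum_le_sum fun μ _ => hfiber μ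
    _ = ((Finset.univ.image Λ).card : ℝ) * r ^ k := by rw [Finset.sum_const, nsmul_eq_mul]
    _ ≤ ((k : ℝ) + 1) ^ Fintype.card κ * r ^ k := by
        gcongr
        · exact (norm_nonneg _).trans (hbound 1 one_pos)
        · exact_mod_cast himage

/-- The supremum over `t > 0` of `|∑ᵢ e^{i(λᵢt - θᵢ)}|` is the number of terms. -/
theorem exists_pos_lt_norm_sum_exp {κ : Type*} [Fintype κ] (lam θ : κ → ℝ)
    (h : ∀ l : κ → ℤ, ∑ i, (l i : ℝ) * lam i = 0 → ∑ i, l i = 0 →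
      ∃ m : ℤ, ∑ i, (l i : ℝ) * θ i = 2 * Real.pi * m) {r : ℝ} (hr : r < Fintype.card κ) :
    ∃ t : ℝ, 0 < t ∧ r < ‖∑ i, Complex.exp (Complex.I * (lam i * t - θ i))‖ := by
  by_contra! hcon
  have hr0 : 0 ≤ r := (norm_nonneg _).trans (hcon 1 one_pos)
  have hpos : (0 : ℝ) < Fintype.card κ := hr0.trans_lt hr
  have hle := card_pow_le_of_norm_sum_exp_le lam θ h hcon
  set N := Fintype.card κ
  set q := r / N with hq
  have hq1 : |q| < 1 := by
    rw [abs_of_nonneg (by positivity), hq, div_lt_one hpos]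
    exact hr
  -- `(k + 1)^N q^k → 0`, since a polynomial is beaten by a geometric sequence
  have hlim : Tendsto (fun k : ℕ => ((k : ℝ) + 1) ^ N * q ^ k) atTop (𝓝 0) := by
    have h1 := tendsto_pow_const_mul_const_pow_of_abs_lt_one N hq1
    have h2 : Tendsto (fun k : ℕ => 2 ^ N * ((k : ℝ) ^ N * q ^ k)) atTop (𝓝 0) := by
      simpa using h1.const_mul (2 ^ N)
    refine squeeze_zero' (.of_forall fun k => by positivity) ?_ h2
    filter_upwards [eventually_ge_atTop 1] with k hk
    rw [← mul_assoc, ← mul_pow]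
    gcongr
    have : (1 : ℝ) ≤ k := by exact_mod_cast hk
    linarith
  obtain ⟨k, hk⟩ := (hlim.eventually_lt_const one_pos).exists
  have := hle k
  rw [hq, div_pow, mul_div_assoc', div_lt_one (by positivity)] at hk
  linarith

/-- If `|1 + e^{iφ}|` is nearly `2` then `φ` is near a multiple of `2π`. -/
theorem exists_int_abs_sub_lt_of_norm_one_add_exp {φ δ : ℝ} (hδ : 0 < δ)
    (hφ : 2 - δ ^ 2 / Real.pi ^ 2 < ‖1 + Complex.exp (Complex.I * φ)‖) :
    ∃ k : ℤ, |φ - 2 * Real.pi * k| < δ := by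
  have hπ := Real.pi_pos
  refine ⟨round (φ / (2 * Real.pi)), ?_⟩
  set k := round (φ / (2 * Real.pi)) with hk
  set ψ := φ - 2 * Real.pi * k with hψ
  have hψπ : |ψ| ≤ Real.pi := by
    have h1 := abs_sub_round (φ / (2 * Real.pi))
    have h2 : ψ = 2 * Real.pi * (φ / (2 * Real.pi) - k) := by
      rw [hψ]
      field_simp
    rw [h2, abs_mul, abs_of_pos (by positivity)]
    nlinarith
  have hcos : Real.cos φ = Real.cos ψ := by
    rw [hψ, mul_comm, Real.cos_sub_int_mul_two_pi]
  have hsq : ‖1 + Complex.exp (Complex.I * φ)‖ ^ 2 = 2 + 2 * Real.cos φ := by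
    rw [mul_comm, Complex.exp_mul_I, ← Complex.ofReal_cos, ← Complex.ofReal_sin, Complex.sq_norm,
      Complex.normSq_apply]
    simp [-Complex.ofReal_cos, -Complex.ofReal_sin]
    nlinarith [Real.sin_sq_add_cos_sq φ]
  have hle2 : ‖1 + Complex.exp (Complex.I * φ)‖ ≤ 2 := by
    refine (norm_add_le _ _).trans ?_
    rw [mul_comm, Complex.norm_exp_ofReal_mul_I]
    norm_num
  have hup := Real.cos_le_one_sub_mul_cos_sq hψπ
  rw [hcos] at hsq
  set n := ‖1 + Complex.exp (Complex.I * φ)‖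
  have hn : 0 ≤ n := norm_nonneg _
  have h1 : 4 - n ^ 2 < 4 * (δ ^ 2 / Real.pi ^ 2) := by nlinarith
  have h2 : ψ ^ 2 / Real.pi ^ 2 < δ ^ 2 / Real.pi ^ 2 := by
    have : 2 / Real.pi ^ 2 * ψ ^ 2 = 2 * (ψ ^ 2 / Real.pi ^ 2) := by ring
    linarith
  have h3 : ψ ^ 2 < δ ^ 2 := (div_lt_div_iff_of_pos_right (by positivity)).1 h2
  exact abs_lt_of_sq_lt_sq h3 hδ.le

/-- **Kronecker's theorem** on simultaneous approximation: if every integer relation between the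
`λᵢ` is a relation modulo `2π` between the `θᵢ`, then there are times `t > 0` at which all `λᵢt`
are as near as desired to `θᵢ` modulo `2π`. -/
theorem kronecker_approximation {ι : Type*} [Fintype ι] (lam θ : ι → ℝ)
    (h : ∀ l : ι → ℤ, ∑ i, (l i : ℝ) * lam i = 0 →
      ∃ m : ℤ, ∑ i, (l i : ℝ) * θ i = 2 * Real.pi * m) {δ : ℝ} (hδ : 0 < δ) :
    ∃ t : ℝ, 0 < t ∧ ∀ i, ∃ k : ℤ, |lam i * t - θ i - 2 * Real.pi * k| < δ := by
  classical
  set η := δ ^ 2 / Real.pi ^ 2 with hη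
  have hη0 : 0 < η := by have := Real.pi_pos; positivity
  -- the extra term `1` is the character of frequency `0`
  obtain ⟨t, ht, hlt⟩ := exists_pos_lt_norm_sum_exp
    (fun o : Option ι => o.elim 0 lam) (fun o => o.elim 0 θ) (by
      intro l hl _
      simp only [Fintype.sum_option, Option.elim_none, mul_zero, zero_add, Option.elim_some] at hl ⊢
      exact h (fun i => l (some i)) hl)
    (r := Fintype.card (Option ι) - η) (by linarith)
  refine ⟨t, ht, fun i => ?_⟩
  refine exists_int_abs_sub_lt_of_norm_one_add_exp hδ ?_
  simp only [Fintype.sum_option, Fintype.card_option, Option.elim_none, Option.elim_some] at hlt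
  rw [← Finset.add_sum_erase _ _ (Finset.mem_univ i)] at hlt
  have hrest : ‖∑ j ∈ Finset.univ.erase i, Complex.exp (Complex.I * (lam j * t - θ j))‖ ≤
      (Fintype.card ι : ℝ) - 1 := by
    refine (norm_sum_le_of_le (n := fun _ => 1) _ fun j _ => ?_).trans ?_
    · rw [Complex.norm_exp]
      simp
    · rw [Finset.sum_const, Finset.card_erase_of_mem (Finset.mem_univ i), nsmul_eq_mul, mul_one,
        Nat.cast_sub (Finset.card_pos.2 ⟨i, Finset.mem_univ i⟩)]
      simp
  rw [← add_assoc] at hlt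
  have := hlt.trans_le (norm_add_le _ _)
  push_cast at this
  simp only [mul_zero, zero_mul, sub_zero, Complex.exp_zero] at this
  push_cast
  linarith

/-- For integers `nᵢ` simultaneous congruences `nᵢs ≡ θᵢ` modulo `2π` can be solved exactly. -/
theorem exists_int_mul_eq_of_int {ι : Type*} [Fintype ι] (n : ι → ℤ) (hn : ∃ i, n i ≠ 0)
    (θ : ι → ℝ) (h : ∀ l : ι → ℤ, ∑ i, l i * n i = 0 →
      ∃ m : ℤ, ∑ i, (l i : ℝ) * θ i = 2 * Real.pi * m) :
    ∃ s : ℝ, ∀ i, ∃ k : ℤ, n i * s - θ i = 2 * Real.pi * k := by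
  classical
  set g := Finset.univ.gcd n with hg
  obtain ⟨i₀, hi₀⟩ := hn
  have hg0 : g ≠ 0 := by
    rw [hg, Finset.gcd_ne_zero_iff]
    exact ⟨i₀, Finset.mem_univ _, hi₀⟩
  obtain ⟨m, hm⟩ := Finset.gcd_eq_sum_mul Finset.univ n
  choose q hq using fun i => Finset.gcd_dvd (f := n) (Finset.mem_univ i)
  have hgR : (g : ℝ) ≠ 0 := by exact_mod_cast hg0
  refine ⟨(∑ j, (m j : ℝ) * θ j) / g, fun i => ?_⟩
  -- Bézout's identity makes `qᵢ m - δᵢ` a relation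
  obtain ⟨k, hk⟩ := h (fun j => q i * m j - if j = i then 1 else 0) (by
    simp only [sub_mul, Finset.sum_sub_distrib, ite_mul, one_mul, zero_mul, Finset.sum_ite_eq',
      Finset.mem_univ, if_true]
    have : ∑ j, q i * m j * n j = q i * g := by
      rw [hg, hm, Finset.mul_sum]
      exact Finset.sum_congr rfl fun j _ => by ring
    rw [this, hq i]
    ring)
  refine ⟨k, ?_⟩
  rw [← hk]
  push_cast
  simp only [sub_mul, Finset.sum_sub_distrib, ite_mul, one_mul, zero_mul, Finset.sum_ite_eq',
    Finset.mem_univ, if_true]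
  have hni : (n i : ℝ) = g * q i := by exact_mod_cast hq i
  have hcancel : (g : ℝ) * q i * ((∑ j, (m j : ℝ) * θ j) / g) = q i * ∑ j, (m j : ℝ) * θ j := by
    field_simp
  rw [hni, hcancel, Finset.mul_sum]
  congr 1
  exact Finset.sum_congr rfl fun j _ => by ring

/-- Kronecker's theorem for commensurable frequencies, with equality instead of approximation. -/
theorem kronecker_exact_of_commensurable {ι : Type*} [Fintype ι] [Nonempty ι] (lam θ : ι → ℝ)
    (hpos : ∀ i, 0 < lam i) (hcomm : ∀ i j, ∃ q : ℚ, lam i = q * lam j)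
    (h : ∀ l : ι → ℤ, ∑ i, (l i : ℝ) * lam i = 0 →
      ∃ m : ℤ, ∑ i, (l i : ℝ) * θ i = 2 * Real.pi * m) :
    ∃ t : ℝ, 0 < t ∧ ∀ i, ∃ k : ℤ, lam i * t - θ i = 2 * Real.pi * k := by
  classical
  obtain ⟨i₀⟩ := ‹Nonempty ι›
  choose q hq using fun i => hcomm i i₀
  -- `λᵢ = c nᵢ` with `c` the quotient of `λ_{i₀}` by a common denominator
  set d : ℕ := ∏ i, (q i).den with hd
  have hd0 : 0 < d := Finset.prod_pos fun i _ => (q i).den_pos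
  set c : ℝ := lam i₀ / d with hc
  have hc0 : 0 < c := div_pos (hpos i₀) (by exact_mod_cast hd0)
  have hint : ∀ i, ∃ n : ℤ, lam i = c * n := by
    intro i
    obtain ⟨e, he⟩ := Finset.dvd_prod_of_mem (fun j => (q j).den) (Finset.mem_univ i)
    refine ⟨(q i).num * e, ?_⟩
    have hden : ((q i).den : ℝ) ≠ 0 := by exact_mod_cast (q i).den_nz
    have hdR : (d : ℝ) = (q i).den * e := by exact_mod_cast he
    have hd0' : (d : ℝ) ≠ 0 := by exact_mod_cast hd0.ne'
    have he0 : (e : ℝ) ≠ 0 := by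
      intro h0
      rw [h0, mul_zero] at hdR
      exact hd0' hdR
    rw [hq i, hc, hdR, Rat.cast_def]
    push_cast
    field_simp
  choose n hn using hint
  obtain ⟨s, hs⟩ := exists_int_mul_eq_of_int n ⟨i₀, by
    intro h0
    have := hpos i₀
    rw [hn i₀, h0] at this
    simp at this⟩ θ (by
    intro l hl
    refine h l ?_
    have : ∑ i, (l i : ℝ) * lam i = c * ((∑ i, l i * n i : ℤ) : ℝ) := by
      push_cast
      rw [Finset.mul_sum]
      exact Finset.sum_congr rfl fun i _ => by rw [hn i]; ring
    rw [this, hl]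
    simp)
  -- the solutions are periodic, so one of them is positive
  obtain ⟨N, hN⟩ := exists_nat_gt (-s / (2 * Real.pi))
  have hπ := Real.pi_pos
  rw [div_lt_iff₀ (by positivity)] at hN
  refine ⟨(s + N * (2 * Real.pi)) / c, div_pos (by linarith) hc0, fun i => ?_⟩
  obtain ⟨k, hk⟩ := hs i
  refine ⟨k + n i * N, ?_⟩
  push_cast
  rw [hn i, mul_comm c, mul_assoc, mul_div_cancel₀ _ hc0.ne']
  linear_combination hk

end

/-! ### Spectral decomposition of the quantum walk -/

namespace WeightedGraph

theorem isHermitian_adjMatrix {V : Type*} (X : WeightedGraph V) : X.adjMatrix.IsHermitian := by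
  ext u v
  by_cases h : X.graph.Adj u v
  · simp [adjMatrix, h, h.symm, Sym2.eq_swap (a := v)]
  · simp [adjMatrix, h, mt SimpleGraph.Adj.symm h]

section
variable {V : Type*} [Fintype V] [DecidableEq V] (X : WeightedGraph V)

/-- The weight `vᵢ(u)²` that the `i`-th eigenvector of an orthonormal eigenbasis gives to `u`. -/
noncomputable def eigenvectorWeight (u i : V) : ℝ :=
  (X.isHermitian_adjMatrix.eigenvectorBasis i u) ^ 2

theorem eigenvectorWeight_nonneg (u i : V) : 0 ≤ X.eigenvectorWeight u i := sq_nonneg _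

theorem transitionMatrix_apply_self (u : V) (t : ℝ) :
    X.transitionMatrix t u u = ∑ i, Complex.exp
      ((t * X.isHermitian_adjMatrix.eigenvalues i : ℝ) * Complex.I) * X.eigenvectorWeight u i := by
  set hA := X.isHermitian_adjMatrix
  set Q : Matrix V V ℝ := (hA.eigenvectorUnitary : Matrix V V ℝ) with hQ
  have hQQ : Q * Q.transpose = 1 := by
    have := Unitary.coe_mul_star_self hA.eigenvectorUnitary
    simpa [Matrix.star_eq_conjTranspose] using this
  have hspec : X.adjMatrix = Q * Matrix.diagonal hA.eigenvalues * Q.transpose := by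
    have := hA.spectral_theorem
    rw [Unitary.conjStarAlgAut_apply] at this
    simpa [Matrix.star_eq_conjTranspose, Function.comp_def] using this
  set C : Matrix V V ℂ := Q.map (fun x : ℝ => (x : ℂ)) with hC
  have hCC : C * C.transpose = 1 := by
    have := congrArg (fun M : Matrix V V ℝ => M.map (Complex.ofRealHom)) hQQ
    simp only [Matrix.map_mul] at this
    rw [Matrix.map_one _ (map_zero _) (map_one _)] at this
    exact this
  have hspecC : (Complex.I * (t : ℂ)) • X.adjMatrix.map (fun x : ℝ => (x : ℂ)) =
      C * Matrix.diagonal (fun i => (t * hA.eigenvalues i : ℝ) * Complex.I) * C⁻¹ := by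
    rw [Matrix.inv_eq_right_inv hCC]
    have h1 : X.adjMatrix.map (fun x : ℝ => (x : ℂ)) =
        C * Matrix.diagonal (fun i => (hA.eigenvalues i : ℂ)) * C.transpose := by
      have := congrArg (fun M : Matrix V V ℝ => M.map (Complex.ofRealHom)) hspec
      simp only [Matrix.map_mul, Matrix.diagonal_map (map_zero Complex.ofRealHom)] at this
      exact this
    have h2 : Matrix.diagonal (fun i => ((t * hA.eigenvalues i : ℝ) : ℂ) * Complex.I) =
        (Complex.I * (t : ℂ)) • Matrix.diagonal (fun i => (hA.eigenvalues i : ℂ)) := by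
      rw [← Matrix.diagonal_smul]
      congr 1
      ext i
      simp only [Pi.smul_apply, smul_eq_mul]
      push_cast
      ring
    rw [h1, h2]
    simp
  rw [transitionMatrix, hspecC, Matrix.exp_conj _ _ (IsUnit.of_mul_eq_one _ hCC),
    Matrix.exp_diagonal, Matrix.inv_eq_right_inv hCC, Matrix.mul_apply]
  refine Finset.sum_congr rfl fun i _ => ?_
  rw [Matrix.mul_diagonal, Pi.coe_exp, ← Complex.exp_eq_exp_ℂ]
  simp only [Matrix.transpose_apply, hC, Matrix.map_apply, hQ, eigenvectorWeight,
    Matrix.IsHermitian.eigenvectorUnitary_apply]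
  push_cast
  ring

theorem eigenProjection_apply (θ : ℝ) (u v : V) :
    X.eigenProjection θ u v = (Module.End.eigenspace (Matrix.toEuclideanLin X.adjMatrix) θ
      ).starProjection (EuclideanSpace.single v 1) u := by
  set P := (Module.End.eigenspace (Matrix.toEuclideanLin X.adjMatrix) θ).starProjection
  have : P.toLinearMap (EuclideanSpace.single v 1) =
      Matrix.toEuclideanLin (X.eigenProjection θ) (EuclideanSpace.single v 1) := by
    rw [eigenProjection, LinearEquiv.apply_symm_apply]
  change _ = (P.toLinearMap (EuclideanSpace.single v 1)) u
  rw [this]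
  simp [Matrix.toLpLin_apply]

theorem starProjection_eigenspace_eigenvectorBasis (θ : ℝ) (i : V) :
    (Module.End.eigenspace (Matrix.toEuclideanLin X.adjMatrix) θ).starProjection
      (X.isHermitian_adjMatrix.eigenvectorBasis i) =
    if X.isHermitian_adjMatrix.eigenvalues i = θ then
      X.isHermitian_adjMatrix.eigenvectorBasis i else 0 := by
  set hA := X.isHermitian_adjMatrix
  have hmem : hA.eigenvectorBasis i ∈
      Module.End.eigenspace (Matrix.toEuclideanLin X.adjMatrix) (hA.eigenvalues i) := by
    rw [Module.End.mem_eigenspace_iff]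
    ext j
    have := congrFun (hA.mulVec_eigenvectorBasis i) j
    simpa [Matrix.toLpLin_apply] using this
  split_ifs with h
  · rw [Submodule.starProjection_eq_self_iff, ← h]
    exact hmem
  · rw [Submodule.starProjection_apply_eq_zero_iff]
    have hsym := Matrix.isSymmetric_toEuclideanLin_iff.mpr hA
    intro x hx
    exact hsym.orthogonalFamily_eigenspaces (Ne.symm h) ⟨x, hx⟩ ⟨_, hmem⟩

theorem eigenProjection_apply_self (θ : ℝ) (u : V) :
    X.eigenProjection θ u u =
      ∑ i with X.isHermitian_adjMatrix.eigenvalues i = θ, X.eigenvectorWeight u i := by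
  rw [eigenProjection_apply]
  conv_lhs => rw [← X.isHermitian_adjMatrix.eigenvectorBasis.sum_repr (EuclideanSpace.single u 1)]
  rw [map_sum, Finset.sum_filter, WithLp.ofLp_sum, Finset.sum_apply]
  refine Finset.sum_congr rfl fun i _ => ?_
  rw [map_smul, starProjection_eigenspace_eigenvectorBasis, OrthonormalBasis.repr_apply_apply,
    EuclideanSpace.inner_single_right]
  split_ifs
  · simp [eigenvectorWeight, sq]
  · simp

theorem eigenProjection_apply_self_nonneg (θ : ℝ) (u : V) : 0 ≤ X.eigenProjection θ u u := by
  rw [eigenProjection_apply_self]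
  exact Finset.sum_nonneg fun i _ => X.eigenvectorWeight_nonneg u i

theorem sum_eigenvectorWeight (u : V) : ∑ i, X.eigenvectorWeight u i = 1 := by
  have := X.isHermitian_adjMatrix.eigenvectorBasis.sum_sq_norm_inner_right
    (EuclideanSpace.single u (1 : ℝ))
  simpa [eigenvectorWeight, EuclideanSpace.inner_single_right] using this

/-! ### Symmetry of the spectrum of a bipartite graph -/

/-- Changing the sign of the coordinates in one part of a bipartite graph turns the adjacency
matrix `A` into `-A`, so it carries the `θ`-eigenspace to the `-θ`-eigenspace. -/
theorem eigenProjection_neg_apply_self (hX : X.graph.IsBipartite) (θ : ℝ) (u : V) :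
    X.eigenProjection (-θ) u u = X.eigenProjection θ u u := by
  obtain ⟨col⟩ := hX
  set B : EuclideanSpace ℝ V ≃ₗᵢ[ℝ] EuclideanSpace ℝ V :=
    LinearIsometryEquiv.piLpCongrRight 2 fun v =>
      if col v = 0 then LinearIsometryEquiv.refl ℝ ℝ else LinearIsometryEquiv.neg ℝ with hB
  have hBapply : ∀ x v, B x v = (if col v = 0 then 1 else -1) * x v := by
    intro x v
    simp only [hB, LinearIsometryEquiv.piLpCongrRight_apply]
    split_ifs <;> simp
  have hBB : ∀ x, B (B x) = x := by
    intro x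
    ext v
    rw [hBapply, hBapply]
    split_ifs <;> simp
  have hBsymm : B.symm = B := by
    ext1 x
    rw [LinearIsometryEquiv.symm_apply_eq, hBB]
  have hanti : ∀ x, Matrix.toEuclideanLin X.adjMatrix (B x) =
      -B (Matrix.toEuclideanLin X.adjMatrix x) := by
    intro x
    ext v
    rw [PiLp.neg_apply, hBapply]
    simp only [Matrix.toLpLin_apply, Matrix.mulVec, dotProduct, Finset.mul_sum, hBapply]
    rw [← Finset.sum_neg_distrib]
    refine Finset.sum_congr rfl fun w _ => ?_
    by_cases hvw : X.graph.Adj v w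
    · have hne : col v ≠ col w := col.valid hvw
      have h1 : (if col w = 0 then (1 : ℝ) else -1) = -(if col v = 0 then 1 else -1) := by
        split_ifs <;> first | omega | norm_num
      rw [h1]
      ring
    · simp [adjMatrix, hvw]
  have hmap : (Module.End.eigenspace (Matrix.toEuclideanLin X.adjMatrix) θ).map
      (B.toLinearEquiv : EuclideanSpace ℝ V →ₗ[ℝ] EuclideanSpace ℝ V) =
      Module.End.eigenspace (Matrix.toEuclideanLin X.adjMatrix) (-θ) := by
    ext y
    simp only [Submodule.mem_map, Module.End.mem_eigenspace_iff]
    constructor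
    · rintro ⟨x, hx, rfl⟩
      change Matrix.toEuclideanLin X.adjMatrix (B x) = -θ • B x
      rw [hanti, hx, map_smul, neg_smul]
    · intro hy
      refine ⟨B y, ?_, hBB y⟩
      rw [hanti, hy, map_smul, neg_smul, neg_neg]
  have hsingle : B (EuclideanSpace.single u 1) =
      (if col u = 0 then (1 : ℝ) else -1) • EuclideanSpace.single u (1 : ℝ) := by
    ext v
    rw [hBapply]
    by_cases h : v = u
    · subst h
      split_ifs <;> simp
    · split_ifs <;> simp [h]
  rw [eigenProjection_apply, eigenProjection_apply]
  have key := Submodule.starProjection_map_apply B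
    (Module.End.eigenspace (Matrix.toEuclideanLin X.adjMatrix) θ) (EuclideanSpace.single u 1)
  have key2 : (Module.End.eigenspace (Matrix.toEuclideanLin X.adjMatrix) (-θ)).starProjection
      (EuclideanSpace.single u 1) = B ((Module.End.eigenspace (Matrix.toEuclideanLin X.adjMatrix)
        θ).starProjection (B (EuclideanSpace.single u 1))) := by
    rw [hBsymm] at key
    rw [← key]
    simp only [hmap]
  rw [key2, hsingle, map_smul, map_smul, PiLp.smul_apply, hBapply]
  split_ifs <;> simp

/-- Sums over the spectrum weighted by `vᵢ(u)²` are invariant under `θ ↦ -θ`. -/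
theorem sum_eigenvectorWeight_neg (hX : X.graph.IsBipartite) (u : V) (f : ℝ → ℝ) :
    ∑ i, f (-X.isHermitian_adjMatrix.eigenvalues i) * X.eigenvectorWeight u i =
      ∑ i, f (X.isHermitian_adjMatrix.eigenvalues i) * X.eigenvectorWeight u i := by
  classical
  set μ := X.isHermitian_adjMatrix.eigenvalues
  set T : Finset ℝ := Finset.univ.image μ ∪ Finset.univ.image (fun i => -μ i) with hT
  have hsum : ∀ g : ℝ → ℝ, ∑ i, g (μ i) * X.eigenvectorWeight u i =
      ∑ θ ∈ T, g θ * X.eigenProjection θ u u := by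
    intro g
    rw [← Finset.sum_fiberwise_of_maps_to (t := T) (g := μ) (by intro i _; simp [hT])]
    refine Finset.sum_congr rfl fun θ _ => ?_
    rw [eigenProjection_apply_self, Finset.mul_sum]
    refine Finset.sum_congr rfl fun i hi => ?_
    rw [show μ i = θ from (Finset.mem_filter.1 hi).2]
  have hmem : ∀ θ ∈ T, -θ ∈ T := by
    intro θ hθ
    simp only [hT, Finset.mem_union, Finset.mem_image, Finset.mem_univ, true_and] at hθ ⊢
    rcases hθ with ⟨i, rfl⟩ | ⟨i, rfl⟩
    · exact Or.inr ⟨i, rfl⟩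
    · exact Or.inl ⟨i, (neg_neg _).symm⟩
  rw [hsum fun x => f (-x), hsum f]
  refine Finset.sum_nbij' (fun θ => -θ) (fun θ => -θ) hmem hmem (by simp) (by simp) ?_
  intro θ _
  rw [X.eigenProjection_neg_apply_self hX]

theorem transitionMatrix_apply_self_re (u : V) (t : ℝ) :
    (X.transitionMatrix t u u).re =
      ∑ i, Real.cos (t * X.isHermitian_adjMatrix.eigenvalues i) * X.eigenvectorWeight u i := by
  rw [transitionMatrix_apply_self, Complex.re_sum]
  refine Finset.sum_congr rfl fun i _ => ?_
  rw [Complex.re_mul_ofReal, Complex.exp_ofReal_mul_I_re]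

theorem transitionMatrix_apply_self_im (hX : X.graph.IsBipartite) (u : V) (t : ℝ) :
    (X.transitionMatrix t u u).im = 0 := by
  have h : (X.transitionMatrix t u u).im =
      ∑ i, Real.sin (t * X.isHermitian_adjMatrix.eigenvalues i) * X.eigenvectorWeight u i := by
    rw [transitionMatrix_apply_self, Complex.im_sum]
    refine Finset.sum_congr rfl fun i _ => ?_
    rw [Complex.im_mul_ofReal, Complex.exp_ofReal_mul_I_im]
  have hsymm := X.sum_eigenvectorWeight_neg hX u fun x => Real.sin (t * x)
  simp only [mul_neg, Real.sin_neg, neg_mul, Finset.sum_neg_distrib] at hsymm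
  rw [h]
  linarith

/-- The eigenvectors for `λ` and for `-λ` have the same total weight at `u`. -/
theorem sum_eigenvectorWeight_abs (hX : X.graph.IsBipartite) (u : V) {S : Finset ℝ}
    (hS : ∀ x ∈ S, 0 < x) (f : ℝ → ℝ) :
    ∑ i with |X.isHermitian_adjMatrix.eigenvalues i| ∈ S,
        f |X.isHermitian_adjMatrix.eigenvalues i| * X.eigenvectorWeight u i =
      2 * ∑ x ∈ S, f x * X.eigenProjection x u u := by
  classical
  set μ := X.isHermitian_adjMatrix.eigenvalues
  rw [← Finset.sum_fiberwise_of_maps_to (s := Finset.univ.filter fun i => |μ i| ∈ S) (t := S)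
    (g := fun i => |μ i|) (by intro i hi; exact (Finset.mem_filter.1 hi).2), Finset.mul_sum]
  refine Finset.sum_congr rfl fun x hx => ?_
  have hx0 := hS x hx
  have hsplit : ((Finset.univ.filter fun i => |μ i| ∈ S).filter fun i => |μ i| = x) =
      (Finset.univ.filter fun i => μ i = x) ∪ (Finset.univ.filter fun i => μ i = -x) := by
    ext i
    simp only [Finset.mem_filter, Finset.mem_univ, true_and, Finset.mem_union]
    rw [abs_eq hx0.le]
    refine ⟨fun h => h.2, fun h => ⟨?_, h⟩⟩
    rwa [(abs_eq hx0.le).2 h]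
  have hdisj : Disjoint (Finset.univ.filter fun i => μ i = x)
      (Finset.univ.filter fun i => μ i = -x) := by
    refine Finset.disjoint_filter.2 fun i _ h1 h2 => ?_
    linarith
  rw [Finset.sum_congr rfl (g := fun i => f x * X.eigenvectorWeight u i) (by
    intro i hi
    rw [(Finset.mem_filter.1 hi).2]), ← Finset.mul_sum, hsplit, Finset.sum_union hdisj,
    ← eigenProjection_apply_self, ← eigenProjection_apply_self,
    X.eigenProjection_neg_apply_self hX]
  ring

theorem sum_eigenvectorWeight_abs_notMem (hX : X.graph.IsBipartite) (u : V) {S : Finset ℝ}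
    (hS : ∀ x ∈ S, 0 < x) :
    ∑ i with |X.isHermitian_adjMatrix.eigenvalues i| ∉ S, X.eigenvectorWeight u i =
      1 - 2 * X.idempotentWeight u S := by
  have h1 := X.sum_eigenvectorWeight_abs hX u hS fun _ => 1
  have h2 := Finset.sum_filter_add_sum_filter_not Finset.univ
    (fun i => |X.isHermitian_adjMatrix.eigenvalues i| ∈ S) (X.eigenvectorWeight u)
  rw [sum_eigenvectorWeight] at h2
  simp only [one_mul] at h1
  rw [idempotentWeight]
  linarith

theorem idempotentWeight_le_half (hX : X.graph.IsBipartite) (u : V) {S : Finset ℝ}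
    (hS : ∀ x ∈ S, 0 < x) : X.idempotentWeight u S ≤ 1 / 2 := by
  have h := X.sum_eigenvectorWeight_abs_notMem hX u hS
  have h2 : 0 ≤ ∑ i with |X.isHermitian_adjMatrix.eigenvalues i| ∉ S, X.eigenvectorWeight u i :=
    Finset.sum_nonneg fun i _ => X.eigenvectorWeight_nonneg u i
  linarith

/-- Bounding by `1` the cosines that belong to eigenvalues outside `±S`. -/
theorem transitionMatrix_re_le (hX : X.graph.IsBipartite) (u : V) {S : Finset ℝ}
    (hS : ∀ x ∈ S, 0 < x) (t : ℝ) :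
    (X.transitionMatrix t u u).re ≤ 1 - 2 * X.idempotentWeight u S +
      2 * ∑ x ∈ S, Real.cos (t * x) * X.eigenProjection x u u := by
  rw [transitionMatrix_apply_self_re, ← Finset.sum_filter_add_sum_filter_not Finset.univ
    (fun i => |X.isHermitian_adjMatrix.eigenvalues i| ∈ S), ← X.sum_eigenvectorWeight_abs hX u hS
    (fun x => Real.cos (t * x)), ← X.sum_eigenvectorWeight_abs_notMem hX u hS, add_comm]
  have habs : ∀ y : ℝ, Real.cos (t * |y|) = Real.cos (t * y) := by
    intro y
    rcases abs_choice y with h | h <;> rw [h]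
    rw [mul_neg, Real.cos_neg]
  simp only [habs]
  gcongr with i
  exact mul_le_of_le_one_left (X.eigenvectorWeight_nonneg u i) (Real.cos_le_one _)

/-- If all cosines belonging to `S` are at most `c`, then `U(t)_{u,u} ≤ 1 - 2α + 2αc`. -/
theorem transitionMatrix_re_le_of_cos_le (hX : X.graph.IsBipartite) (u : V) {S : Finset ℝ}
    (hS : ∀ x ∈ S, 0 < x) {t c : ℝ} (hc : ∀ x ∈ S, Real.cos (t * x) ≤ c) :
    (X.transitionMatrix t u u).re ≤
      1 - 2 * X.idempotentWeight u S + 2 * (X.idempotentWeight u S * c) := by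
  refine (X.transitionMatrix_re_le hX u hS t).trans ?_
  have h : ∑ x ∈ S, Real.cos (t * x) * X.eigenProjection x u u ≤
      ∑ x ∈ S, c * X.eigenProjection x u u :=
    Finset.sum_le_sum fun x hx =>
      mul_le_mul_of_nonneg_right (hc x hx) (X.eigenProjection_apply_self_nonneg x u)
  rw [← Finset.mul_sum] at h
  rw [idempotentWeight, mul_comm _ c]
  linarith

/-- The walk starts at `1`, so by the intermediate value theorem a return amplitude that is real
and at most `ε` at some time, for every `ε > 0`, has absolute value at most `ε` at some time. -/
theorem notSedentary_of_forall_exists_re_le (hX : X.graph.IsBipartite) (u : V)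
    (h : ∀ ε : ℝ, 0 < ε → ∃ t : ℝ, 0 < t ∧ (X.transitionMatrix t u u).re ≤ ε) :
    X.NotSedentary u := by
  have hnorm : ∀ t, ‖X.transitionMatrix t u u‖ = |(X.transitionMatrix t u u).re| := by
    intro t
    exact (Complex.abs_re_eq_norm.2 (X.transitionMatrix_apply_self_im hX u t)).symm
  have hcont : Continuous fun t => (X.transitionMatrix t u u).re := by
    simp only [transitionMatrix_apply_self_re]
    fun_prop
  have hzero : (X.transitionMatrix 0 u u).re = 1 := by
    rw [transitionMatrix_apply_self_re]
    simpa using X.sum_eigenvectorWeight u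
  have hbdd : BddBelow (Set.range fun t : Set.Ioi (0 : ℝ) => ‖X.transitionMatrix (t : ℝ) u u‖) :=
    ⟨0, by rintro _ ⟨t, rfl⟩; exact norm_nonneg _⟩
  refine le_antisymm (le_of_forall_pos_le_add fun ε hε => ?_)
    (Real.iInf_nonneg fun t => norm_nonneg _)
  rw [zero_add]
  obtain ⟨t, ht, hle⟩ := h ε hε
  obtain ⟨s, hs, hsε⟩ : ∃ s : ℝ, 0 < s ∧ ‖X.transitionMatrix s u u‖ ≤ ε := by
    rcases le_total 0 (X.transitionMatrix t u u).re with h0 | h0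
    · exact ⟨t, ht, by rwa [hnorm, abs_of_nonneg h0]⟩
    · obtain ⟨s, hs, hs0⟩ := intermediate_value_Icc' ht.le hcont.continuousOn
        (show (0 : ℝ) ∈ Set.Icc (X.transitionMatrix t u u).re (X.transitionMatrix 0 u u).re from
          ⟨h0, hzero ▸ zero_le_one⟩)
      refine ⟨s, hs.1.lt_of_ne ?_, ?_⟩
      · rintro rfl
        simp only [hzero] at hs0
        exact one_ne_zero hs0
      · simp only at hs0
        rw [hnorm, hs0, abs_zero]
        exact hε.le
  exact (ciInf_le hbdd ⟨s, hs⟩).trans hsε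

/-! ### Times at which the return amplitude is nearly nonpositive -/

variable {X} {u : V} {S : Finset ℝ}

theorem IsAdmissible.pos (h : X.IsAdmissible u S) : ∀ x ∈ S, 0 < x := fun _ hx => (h.2.1 hx).2

theorem IsAdmissible.angle_mem_Ioc (h : X.IsAdmissible u S) :
    X.angle u S ∈ Set.Ioc (Real.pi / 2) Real.pi := by
  have hα : 0 < X.idempotentWeight u S := lt_of_lt_of_le (by norm_num) h.2.2
  refine ⟨?_, Real.arccos_le_pi _⟩
  rw [angle, ← not_le, Real.arccos_le_pi_div_two, not_le, neg_lt_zero]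
  positivity

theorem IsAdmissible.cos_angle (h : X.IsAdmissible u S) :
    Real.cos (X.angle u S) = -(1 / (4 * X.idempotentWeight u S)) := by
  have hα : 0 < X.idempotentWeight u S := lt_of_lt_of_le (by norm_num) h.2.2
  refine Real.cos_arccos ?_ ?_
  · rw [neg_le_neg_iff, div_le_one (by positivity)]
    linarith [h.2.2]
  · exact (neg_nonpos.2 (by positivity)).trans zero_le_one

/-- At a time within `δ` of the target phases, the estimate `-1/(4α)` for the cosines belonging to
`S` gives `U(t)_{u,u} ≤ 1/2 - 2α + 2αδ`, and `α ≤ 1/2`. -/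
theorem IsAdmissible.transitionMatrix_re_le (hX : X.graph.IsBipartite) (h : X.IsAdmissible u S)
    {θ : ℝ → ℝ} (hθ : ∀ x, Real.cos (θ x) = Real.cos (X.angle u S)) {t δ : ℝ} (hδ : 0 ≤ δ)
    (ht : ∀ x ∈ S, ∃ k : ℤ, |x * t - θ x - 2 * Real.pi * k| ≤ δ) :
    (X.transitionMatrix t u u).re ≤ 1 / 2 - 2 * X.idempotentWeight u S + δ := by
  have hα : 0 < X.idempotentWeight u S := lt_of_lt_of_le (by norm_num) h.2.2
  have hcos : ∀ x ∈ S, Real.cos (t * x) ≤ -(1 / (4 * X.idempotentWeight u S)) + δ := by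
    intro x hx
    obtain ⟨k, hk⟩ := ht x hx
    have h1 : Real.cos (t * x) = Real.cos (x * t - 2 * Real.pi * k) := by
      rw [mul_comm (2 * Real.pi), Real.cos_sub_int_mul_two_pi, mul_comm]
    have h2 := Real.abs_cos_sub_cos_le (x * t - 2 * Real.pi * k) (θ x)
    rw [h1, ← h.cos_angle, ← hθ x]
    have h3 : x * t - 2 * Real.pi * k - θ x = x * t - θ x - 2 * Real.pi * k := by ring
    rw [h3] at h2
    linarith [(abs_le.1 (h2.trans hk)).2]
  have hle := X.transitionMatrix_re_le_of_cos_le hX u h.pos hcos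
  have hhalf := X.idempotentWeight_le_half hX u h.pos
  have h4 : X.idempotentWeight u S * (-(1 / (4 * X.idempotentWeight u S)) + δ) =
      -(1 / 4) + X.idempotentWeight u S * δ := by
    field_simp
  rw [h4] at hle
  nlinarith

/-- Under the hypothesis of Kronecker's theorem for the frequencies in `S` and the phases `-ζ` on
`S \ S'` and `ζ` on `S'`, there are suitable times. -/
theorem IsAdmissible.nonposNear (hX : X.graph.IsBipartite) (h : X.IsAdmissible u S)
    {S' : Finset ℝ} (hS' : S' ⊆ S)
    (hrel : ∀ l : ℝ → ℤ, IsIntegerRelation S l →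
      ∃ m : ℤ, X.angle u S * signedSum S S' l = 2 * Real.pi * m) :
    X.NonposNear u S S' := by
  classical
  intro ε hε
  set ζ := X.angle u S with hζ
  set α := X.idempotentWeight u S with hα
  set θ : ℝ → ℝ := fun x => if x ∈ S' then ζ else -ζ with hθ
  have hθcos : ∀ x, Real.cos (θ x) = Real.cos (X.angle u S) := by
    intro x
    simp only [hθ]
    split_ifs
    · rfl
    · exact Real.cos_neg _
  have hkron : ∀ l : S → ℤ, ∑ i, (l i : ℝ) * (i : ℝ) = 0 →
      ∃ m : ℤ, ∑ i, (l i : ℝ) * θ i = 2 * Real.pi * m := by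
    intro l hl
    set L : ℝ → ℤ := fun x => if hx : x ∈ S then l ⟨x, hx⟩ else 0 with hL
    have hLsum : ∀ f : ℝ → ℝ, ∑ i, (l i : ℝ) * f i = ∑ x ∈ S, (L x : ℝ) * f x := by
      intro f
      rw [← Finset.sum_coe_sort S]
      exact Finset.sum_congr rfl fun i _ => by simp [hL]
    rw [hLsum fun x => x] at hl
    obtain ⟨m, hm⟩ := hrel L (by
      rw [IsIntegerRelation, ← hl]
      exact Finset.sum_congr rfl fun x _ => mul_comm _ _)
    refine ⟨-m, ?_⟩
    rw [hLsum, ← Finset.sum_sdiff hS']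
    have h1 : ∑ x ∈ S \ S', (L x : ℝ) * θ x = -(ζ * ∑ x ∈ S \ S', (L x : ℝ)) := by
      rw [Finset.mul_sum, ← Finset.sum_neg_distrib]
      refine Finset.sum_congr rfl fun x hx => ?_
      simp only [hθ, if_neg (Finset.mem_sdiff.1 hx).2]
      ring
    have h2 : ∑ x ∈ S', (L x : ℝ) * θ x = ζ * ∑ x ∈ S', (L x : ℝ) := by
      rw [Finset.mul_sum]
      refine Finset.sum_congr rfl fun x hx => ?_
      simp only [hθ, if_pos hx]
      ring
    rw [h1, h2]
    simp only [signedSum] at hm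
    push_cast at hm ⊢
    linarith
  have hmin : 0 < S.min' h.1 := h.pos _ (S.min'_mem h.1)
  obtain ⟨δ, hδ, hδε, hδmin, hδα⟩ : ∃ δ : ℝ, 0 < δ ∧ δ ≤ ε ∧ δ ≤ ε * S.min' h.1 ∧
      (1 / 4 < α → δ ≤ 2 * α - 1 / 2) := by
    by_cases hlt : 1 / 4 < α
    · exact ⟨min (min ε (ε * S.min' h.1)) (2 * α - 1 / 2),
        lt_min (lt_min hε (mul_pos hε hmin)) (by linarith),
        (min_le_left _ _).trans (min_le_left _ _), (min_le_left _ _).trans (min_le_right _ _),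
        fun _ => min_le_right _ _⟩
    · exact ⟨min ε (ε * S.min' h.1), lt_min hε (mul_pos hε hmin), min_le_left _ _,
        min_le_right _ _, fun h' => absurd h' hlt⟩
  obtain ⟨t, ht, happrox, hexact⟩ : ∃ t : ℝ, 0 < t ∧
      (∀ x ∈ S, ∃ k : ℤ, |x * t - θ x - 2 * Real.pi * k| < δ) ∧
      ((∀ x ∈ S, ∀ y ∈ S, ∃ q : ℚ, x = q * y) →
        ∀ x ∈ S, ∃ k : ℤ, |x * t - θ x - 2 * Real.pi * k| ≤ 0) := by
    by_cases hcomm : ∀ x ∈ S, ∀ y ∈ S, ∃ q : ℚ, x = q * y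
    · have : Nonempty S := h.1.to_subtype
      obtain ⟨t, ht, hk⟩ := kronecker_exact_of_commensurable (fun i : S => (i : ℝ))
        (fun i => θ i) (fun i => h.pos i i.2) (fun i j => hcomm i i.2 j j.2) hkron
      have hzero : ∀ x ∈ S, ∃ k : ℤ, |x * t - θ x - 2 * Real.pi * k| ≤ 0 := by
        intro x hx
        obtain ⟨k, hk⟩ := hk ⟨x, hx⟩
        exact ⟨k, (abs_eq_zero.2 (sub_eq_zero.2 hk)).le⟩
      refine ⟨t, ht, fun x hx => ?_, fun _ => hzero⟩
      obtain ⟨k, hk⟩ := hzero x hx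
      exact ⟨k, hk.trans_lt hδ⟩
    · obtain ⟨t, ht, hk⟩ := kronecker_approximation (fun i : S => (i : ℝ)) (fun i => θ i) hkron hδ
      exact ⟨t, ht, fun x hx => hk ⟨x, hx⟩, fun h' => absurd h' hcomm⟩
  have hnear : ∀ x ∈ S, ∃ k : ℤ, |t - (θ x + 2 * Real.pi * k) / x| < ε := by
    intro x hx
    have hx0 := h.pos x hx
    obtain ⟨k, hk⟩ := happrox x hx
    refine ⟨k, ?_⟩
    have : t - (θ x + 2 * Real.pi * k) / x = (x * t - θ x - 2 * Real.pi * k) / x := by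
      field_simp
      ring
    rw [this, abs_div, abs_of_pos hx0, div_lt_iff₀ hx0]
    exact hk.trans_le (hδmin.trans (mul_le_mul_of_nonneg_left (S.min'_le x hx) hε.le))
  have hle := h.transitionMatrix_re_le hX hθcos hδ.le fun x hx => (happrox x hx).imp fun _ => le_of_lt
  have hα4 : 1 / 4 ≤ α := h.2.2
  refine ⟨t, ht, ?_, ?_, X.transitionMatrix_apply_self_im hX u t, by linarith, ?_⟩
  · intro x hx
    obtain ⟨k, hk⟩ := hnear x (Finset.mem_sdiff.1 hx).1
    simp only [hθ, if_neg (Finset.mem_sdiff.1 hx).2] at hk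
    exact ⟨k, hk⟩
  · intro x hx
    obtain ⟨k, hk⟩ := hnear x (hS' hx)
    simp only [hθ, if_pos hx] at hk
    exact ⟨k, hk⟩
  · rintro (hlt | hcomm)
    · linarith [hδα hlt]
    · linarith [h.transitionMatrix_re_le hX hθcos le_rfl (hexact hcomm)]

theorem NonposNear.notSedentary {S' : Finset ℝ} (hX : X.graph.IsBipartite)
    (h : X.NonposNear u S S') : X.NotSedentary u := by
  refine X.notSedentary_of_forall_exists_re_le hX u fun ε hε => ?_
  obtain ⟨t, ht, -, -, -, hle, -⟩ := h ε hε
  exact ⟨t, ht, hle⟩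

theorem IsAdmissible.notSedentary_of_linearIndepOn (hX : X.graph.IsBipartite)
    (h : X.IsAdmissible u S) (hS : LinearIndepOn ℚ id (S : Set ℝ)) : X.NotSedentary u := by
  refine NonposNear.notSedentary hX (h.nonposNear hX (Finset.empty_subset S) fun l hl => ⟨0, ?_⟩)
  rw [linearIndepOn_finset_iff] at hS
  have hzero := hS (fun x => (l x : ℚ)) (by
    rw [← hl]
    refine Finset.sum_congr rfl fun x _ => ?_
    rw [id, Rat.smul_def, mul_comm]
    push_cast
    rfl)
  have hD : signedSum S ∅ l = 0 := by
    rw [signedSum, Finset.sdiff_empty, Finset.sum_empty, sub_zero]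
    exact Finset.sum_eq_zero fun x hx => by exact_mod_cast hzero x hx
  rw [hD]
  simp

end

end WeightedGraph

/-! ### Two-adic conditions -/

/-- If all elements of `T` have `2`-adic valuation `η`, then at `t = π/2^η` all the phases `tx` are
odd multiples of `π`. -/
theorem IsIntegralWithEqualNu2.exists_cos_eq_neg_one {T : Set ℝ} (hT : IsIntegralWithEqualNu2 T) :
    ∃ t : ℝ, 0 < t ∧ ∀ x ∈ T, Real.cos (t * x) = -1 := by
  obtain ⟨η, hη⟩ := hT
  refine ⟨Real.pi / 2 ^ η, by have := Real.pi_pos; positivity, fun x hx => ?_⟩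
  obtain ⟨k, rfl, hk⟩ := hη x hx
  rw [nu2, emultiplicity_eq_coe] at hk
  obtain ⟨⟨c, rfl⟩, hnd⟩ := hk
  have hodd : Odd c := by
    rw [← Int.not_even_iff_odd, even_iff_two_dvd]
    rintro ⟨d, rfl⟩
    exact hnd ⟨d, by ring⟩
  obtain ⟨j, rfl⟩ := hodd
  rw [← Real.cos_int_mul_two_pi_add_pi j]
  congr 1
  push_cast
  field_simp

/-- If `ζ = aπ/b`, the divisibility condition on `D` says that `ζD` is a multiple of `2π`. -/
theorem exists_mul_eq_two_pi_mul_of_nu2_lt {ζ : ℝ} {a b D : ℤ} (hb : b ≠ 0)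
    (hζ : ζ = a * Real.pi / b) (hdvd : b ∣ D) (hnu : nu2 b < nu2 D + nu2 a) :
    ∃ m : ℤ, ζ * D = 2 * Real.pi * m := by
  obtain ⟨c, rfl⟩ := hdvd
  have h2 : (2 : ℤ) ∣ c * a := by
    by_contra hca
    rw [nu2, nu2, nu2, ← emultiplicity_mul Int.prime_two, mul_assoc,
      emultiplicity_mul Int.prime_two, emultiplicity_eq_zero.2 hca, add_zero] at hnu
    exact lt_irrefl _ hnu
  obtain ⟨m, hm⟩ := h2
  refine ⟨m, ?_⟩
  have hbR : (b : ℝ) ≠ 0 := by exact_mod_cast hb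
  have hmR : (c : ℝ) * a = 2 * m := by exact_mod_cast hm
  rw [hζ]
  push_cast
  field_simp
  linear_combination hmR

namespace WeightedGraph

section
variable {V : Type*} [Fintype V] [DecidableEq V] {X : WeightedGraph V} {u : V} {S : Finset ℝ}

theorem IsAdmissible.notSedentary_of_isIntegralWithEqualNu2 (hX : X.graph.IsBipartite)
    (h : X.IsAdmissible u S) (hS : IsIntegralWithEqualNu2 (S : Set ℝ)) : X.NotSedentary u := by
  obtain ⟨t, ht, hcos⟩ := hS.exists_cos_eq_neg_one
  refine X.notSedentary_of_forall_exists_re_le hX u fun ε hε => ⟨t, ht, ?_⟩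
  have hle := X.transitionMatrix_re_le_of_cos_le hX u h.pos fun x hx => (hcos x hx).le
  linarith [h.2.2]

/-! ### The positive part of the eigenvalue support -/

variable (X u)

theorem finite_positiveSupport : (X.positiveSupport u).Finite :=
  (Matrix.finite_real_spectrum (A := X.adjMatrix)).subset fun _ hθ => hθ.1.1

/-- Only eigenvalues in the support have eigenvectors that do not vanish at `u`. -/
theorem eigenvectorWeight_eq_zero_of_abs_notMem (hX : X.graph.IsBipartite) {i : V}
    (hi : X.isHermitian_adjMatrix.eigenvalues i ≠ 0)
    (hmem : |X.isHermitian_adjMatrix.eigenvalues i| ∉ X.positiveSupport u) :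
    X.eigenvectorWeight u i = 0 := by
  set μ := X.isHermitian_adjMatrix.eigenvalues with hμ
  have hproj : X.eigenProjection |μ i| u u = 0 := by
    by_contra hne
    refine hmem ⟨⟨?_, fun hzero => hne ?_⟩, abs_pos.2 hi⟩
    · rw [eigenProjection_apply_self] at hne
      obtain ⟨j, hj, -⟩ := Finset.exists_ne_zero_of_sum_ne_zero hne
      rw [← (Finset.mem_filter.1 hj).2]
      exact X.isHermitian_adjMatrix.eigenvalues_mem_spectrum_real j
    · have := congrFun hzero u
      rwa [Matrix.mulVec_single_one] at this
  have hproj' : X.eigenProjection (μ i) u u = 0 := by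
    rcases abs_choice (μ i) with h | h
    · rwa [h] at hproj
    · rwa [h, X.eigenProjection_neg_apply_self hX] at hproj
  rw [eigenProjection_apply_self, Finset.sum_eq_zero_iff_of_nonneg
    fun j _ => X.eigenvectorWeight_nonneg u j] at hproj'
  exact hproj' i (by simp [hμ])

theorem eigenProjection_zero_add_two_mul_idempotentWeight (hX : X.graph.IsBipartite) :
    X.eigenProjection 0 u u + 2 * X.idempotentWeight u (X.finite_positiveSupport u).toFinset =
      1 := by
  have hpos : ∀ x ∈ (X.finite_positiveSupport u).toFinset, 0 < x := fun x hx =>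
    ((X.finite_positiveSupport u).mem_toFinset.1 hx).2
  have h := X.sum_eigenvectorWeight_abs_notMem hX u hpos
  have h0 : X.eigenProjection 0 u u = 1 -
      2 * X.idempotentWeight u (X.finite_positiveSupport u).toFinset := by
    rw [← h, eigenProjection_apply_self]
    refine Finset.sum_subset ?_ ?_
    · intro i hi
      simp only [Finset.mem_filter, Finset.mem_univ, true_and] at hi ⊢
      rw [hi, abs_zero]
      exact fun hmem => lt_irrefl _ (hpos 0 hmem)
    · intro i hi hi0
      simp only [Finset.mem_filter, Finset.mem_univ, true_and, Set.Finite.mem_toFinset] at hi hi0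
      exact X.eigenvectorWeight_eq_zero_of_abs_notMem u hX hi0 hi
  linarith

theorem isAdmissible_positiveSupport (hX : X.graph.IsBipartite)
    (h0 : X.eigenProjection 0 u u < 1 / 2) (hne : (X.positiveSupport u).Nonempty) :
    X.IsAdmissible u (X.finite_positiveSupport u).toFinset := by
  refine ⟨(X.finite_positiveSupport u).toFinset_nonempty.2 hne, by simp, ?_⟩
  linarith [X.eigenProjection_zero_add_two_mul_idempotentWeight u hX]

end

end WeightedGraph

theorem mainTheorem6 {V : Type*} [Fintype V] [DecidableEq V] (X : WeightedGraph V)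
    (hX : X.graph.IsBipartite) (u : V) (h0 : (0 : ℝ) ∈ X.eigenvalueSupport u) :
    (∀ S : Finset ℝ, X.IsAdmissible u S →
      X.angle u S ∈ Set.Ioc (Real.pi / 2) Real.pi ∧
      -- the case in which `ζ` is not a rational multiple of `π`
      ((¬ ∃ q : ℚ, X.angle u S = q * Real.pi) →
        ∀ S' ⊆ S, (∀ l : ℝ → ℤ, IsIntegerRelation S l → signedSum S S' l = 0) →
          X.NotSedentary u ∧ X.NonposNear u S S') ∧
      -- the case `ζ = aπ/b`; the valuation condition is `ν₂(D) > ν₂(b) - ν₂(a)`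
      (∀ a b : ℤ, b ≠ 0 → Int.gcd a b = 1 → X.angle u S = a * Real.pi / b →
        ∀ S' ⊆ S, (∀ l : ℝ → ℤ, IsIntegerRelation S l →
            b ∣ signedSum S S' l ∧ nu2 b < nu2 (signedSum S S' l) + nu2 a) →
          X.NotSedentary u ∧ X.NonposNear u S S') ∧
      -- special classes of sets `S`
      (LinearIndepOn ℚ id (S : Set ℝ) ∨ IsIntegralWithEqualNu2 (S : Set ℝ) →
        X.NotSedentary u)) ∧
    -- conditions on the whole positive part of the support
    (X.eigenProjection 0 u u < 1 / 2 →
      ((X.positiveSupport u).ncard = 1 ∨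
        (2 ≤ (X.positiveSupport u).ncard ∧
          (IsIntegralWithEqualNu2 (X.positiveSupport u) ∨
            LinearIndepOn ℚ id (X.positiveSupport u)))) →
      X.NotSedentary u) := by
  refine ⟨fun S hS => ⟨hS.angle_mem_Ioc, fun _ S' hS' hD => ?_,
    fun a b hb _ hζ S' hS' hD => ?_, ?_⟩, fun hhalf hsupp => ?_⟩
  · have hnear := hS.nonposNear hX hS' fun l hl => ⟨0, by simp [hD l hl]⟩
    exact ⟨hnear.notSedentary hX, hnear⟩
  · have hnear := hS.nonposNear hX hS' fun l hl =>
      exists_mul_eq_two_pi_mul_of_nu2_lt hb hζ (hD l hl).1 (hD l hl).2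
    exact ⟨hnear.notSedentary hX, hnear⟩
  · rintro (hlin | hint)
    · exact hS.notSedentary_of_linearIndepOn hX hlin
    · exact hS.notSedentary_of_isIntegralWithEqualNu2 hX hint
  · have hne : (X.positiveSupport u).Nonempty := by
      rw [← Set.ncard_pos (X.finite_positiveSupport u)]
      omega
    have hadm := X.isAdmissible_positiveSupport u hX hhalf hne
    have hcoe := (X.finite_positiveSupport u).coe_toFinset
    rcases hsupp with hone | ⟨-, hint | hlin⟩
    · obtain ⟨x, hx⟩ := Set.ncard_eq_one.1 hone
      have hx0 : x ≠ 0 := by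
        have hmem : x ∈ X.positiveSupport u := by simp [hx]
        exact (Set.mem_Ioi.1 hmem.2).ne'
      refine hadm.notSedentary_of_linearIndepOn hX ?_
      rw [hcoe, hx]
      exact LinearIndepOn.singleton hx0
    · exact hadm.notSedentary_of_isIntegralWithEqualNu2 hX (hcoe.symm ▸ hint)
    · exact hadm.notSedentary_of_linearIndepOn hX (hcoe.symm ▸ hlin)
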